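/- Work over $\mathbb C$. A vector $\gamma=(\gamma_0,\dots,\gamma_5)\neq 0$ represents the plane conic $\gamma_0x_0^2+\gamma_1x_0x_1+\gamma_2x_0x_2+\gamma_3x_1^2+\gamma_4x_1x_2+\gamma_5x_2^2=0$, a point of $\mathbb P^5$. Write $\nu(x)$ for the vector of all degree-two monomials in $x$ and, for a matrix $A$, $\nu(A)$ for the matrix with $\nu(Ax)=\nu(A)\nu(x)$. For $h\in(\mathbb P^3)^*$ put $$\hat H(h)=\begin{bmatrix} h_0&0&0&-h_2&-h_3&0\\ 0&h_0&0&h_1&0&-h_3\\ 0&0&h_0&0&h_1&h_2\end{bmatrix},$$ which sends a line in Plücker coordinates $([01],[02],[03],[12],[13],[23])$ to its intersection with the plane $h$. For a camera, i.e. a rank-three $3\times4$ matrix $C$, with center $c$ (spanning $\ker C$), let $\hat C=E(c)C^\dagger$, where $CC^\dagger=I$ and $$E(c)=\begin{bmatrix} c_1&-c_0&0&0\\ c_2&0&-c_0&0\\ c_3&0&0&-c_0\\ 0&c_2&-c_1&0\\ 0&c_3&0&-c_1\\ 0&0&c_3&-c_2\end{bmatrix};$$ $\hat C$ sends an image point to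 its back-projected line. For an arrangement $\mathbf C=(C_1,\dots,C_n)$ of cameras, the conic multiview variety $\mathcal C_{\mathbf C,2}\subseteq(\mathbb P^5)^n$ is the Zariski closure of the image of the rational map $$(\mathbb P^3)^*\times\mathbb P^5\dashrightarrow(\mathbb P^5)^n,\qquad (h,\alpha)\mapsto\big(\nu(\hat C_1)^\top\nu(\hat H(h))^\top\alpha,\ \dots,\ \nu(\hat C_n)^\top\nu(\hat H(h))^\top\alpha\big),$$ which sends a conic in a plane of $\mathbb P^3$ to its images under the $n$ cameras. **Theorem.** Let $\mathbf C=(\begin{bmatrix}0&I\end{bmatrix},\begin{bmatrix}I&0\end{bmatrix})$. For $(\gamma,\delta)\in\mathbb P^5\times\mathbb P^5$ we have $(\gamma,\delta)\in\mathcal C_{\mathbf C,2}$ if and only if $$\operatorname{rank}\begin{bmatrix}\gamma_4^2-4\gamma_3\gamma_5&\gamma_2\gamma_4-2\gamma_1\gamma_5&\gamma_2^2-4\gamma_0\gamma_5\\ \delta_2^2-4\delta_0\delta_5&\delta_1\delta_2-2\delta_0\delta_4&\delta_1^2-4\delta_0\delta_3\end{bmatrix}\le 1 .$$ Moreover, in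 $\mathbb C[\gamma_0,\dots,\gamma_5,\delta_0,\dots,\delta_5]$, the ideal generated by the $2\times2$ minors of this matrix is the defining ideal of $\mathcal C_{\mathbf C,2}$, i.e. the ideal of all polynomials that vanish on it, and this ideal is prime. -/

import Mathlib

namespace ConicMultiview

/-! ### Quadratic forms in coordinates, and the degree-two Veronese embedding

The monomials of degree two in `x₀, …, x_N` are indexed by unordered pairs `s(i, j)` of indices,
so that a quadratic form is its vector of coefficients `Sym2 (Fin (N + 1)) → ℂ`. -/

/-- The Veronese vector of all monomials `xᵢ xⱼ`. -/
def veronese {n : ℕ} (x : Fin n → ℂ) : Sym2 (Fin n) → ℂ :=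
  fun s => Sym2.lift ⟨fun i j => x i * x j, fun _ _ => mul_comm _ _⟩ s

/-- The matrix `ν(A)` with `ν(A x) = ν(A) ν(x)`: its entry in row `s(i, j)` and column `t` is the
coefficient of the monomial `t` in `(A x)ᵢ (A x)ⱼ`. -/
def veroneseMatrix {m n : ℕ} (A : Matrix (Fin m) (Fin n) ℂ) :
    Matrix (Sym2 (Fin m)) (Sym2 (Fin n)) ℂ :=
  fun s t => Sym2.lift
    ⟨fun i j => ∑ p : Fin n × Fin n, if s(p.1, p.2) = t then A i p.1 * A j p.2 else 0, by
      intro i j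
      refine Fintype.sum_equiv (Equiv.prodComm _ _) _ _ fun p => ?_
      simp only [Equiv.prodComm_apply, Prod.fst_swap, Prod.snd_swap]
      rw [Sym2.eq_swap, mul_comm]
      congr⟩ s

theorem veroneseMatrix_mulVec {m n : ℕ} (A : Matrix (Fin m) (Fin n) ℂ) (x : Fin n → ℂ) :
    (veroneseMatrix A).mulVec (veronese x) = veronese (A.mulVec x) := by
  funext s
  induction s using Sym2.ind with
  | _ i j =>
    simp only [Matrix.mulVec, dotProduct, veroneseMatrix, veronese, Sym2.lift_mk, Finset.sum_mul,
      Finset.mul_sum]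
    rw [Finset.sum_comm, Fintype.sum_prod_type]
    refine Eq.trans ?_ Finset.sum_comm
    refine Finset.sum_congr rfl fun k _ => Finset.sum_congr rfl fun l _ => ?_
    rw [Finset.sum_eq_single s(k, l)]
    · simp only [if_true, Sym2.lift_mk]
      ring
    · intro t _ ht
      simp [ht.symm]
    · simp

/-- Coefficient vectors of plane conics
`γ₀ x₀² + γ₁ x₀ x₁ + γ₂ x₀ x₂ + γ₃ x₁² + γ₄ x₁ x₂ + γ₅ x₂²`, with `γₖ = γ (mon k)`. -/
abbrev ConicVec : Type := Sym2 (Fin 3) → ℂ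

/-- The six monomials of a plane conic in the order `x₀², x₀x₁, x₀x₂, x₁², x₁x₂, x₂²`. -/
def mon : Fin 6 → Sym2 (Fin 3) :=
  ![s(0, 0), s(0, 1), s(0, 2), s(1, 1), s(1, 2), s(2, 2)]

/-- The projective space `ℙ⁵` of plane conics. -/
abbrev ConicSpace : Type := Projectivization ℂ ConicVec

/-! ### Plane conics in space and their images under cameras -/

/-- The matrix `Ĥ(h)`. It sends a line of `ℙ³`, in Plücker coordinates
`[01], [02], [03], [12], [13], [23]`, to its point of intersection with the plane `h`, in the
coordinates of that plane given by `x ↦ (-h₁x₀ - h₂x₁ - h₃x₂, h₀x₀, h₀x₁, h₀x₂)`. -/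
def planeMatrix (h : Fin 4 → ℂ) : Matrix (Fin 3) (Fin 6) ℂ :=
  !![h 0, 0, 0, -h 2, -h 3, 0;
     0, h 0, 0, h 1, 0, -h 3;
     0, 0, h 0, 0, h 1, h 2]

/-- The Chow form `ν(Ĥ(h))ᵀ α`, a quadratic form in Plücker coordinates, of the conic with
coefficients `α` in the plane `h`. -/
def chowForm (h : Fin 4 → ℂ) (α : ConicVec) : Sym2 (Fin 6) → ℂ :=
  (veroneseMatrix (planeMatrix h)).transpose.mulVec α

/-- The matrix `E(c)`; `E(c) X` is the vector of Plücker coordinates of the line through `c`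
and `X`. -/
def joinMatrix (c : Fin 4 → ℂ) : Matrix (Fin 6) (Fin 4) ℂ :=
  !![c 1, -c 0, 0, 0;
     c 2, 0, -c 0, 0;
     c 3, 0, 0, -c 0;
     0, c 2, -c 1, 0;
     0, c 3, 0, -c 1;
     0, 0, c 3, -c 2]

/-- `B` is a back-projection matrix `Ĉ = E(c) C†` of the camera `C`, for its center `c` and a
right inverse `C†` of `C`: it sends an image point to its back-projected line. For a camera `C`
(a matrix of rank three), it exists and is unique up to a nonzero scalar. -/
def IsBackProjection (C : Matrix (Fin 3) (Fin 4) ℂ) (B : Matrix (Fin 6) (Fin 3) ℂ) : Prop :=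
  ∃ (c : Fin 4 → ℂ) (D : Matrix (Fin 4) (Fin 3) ℂ),
    c ≠ 0 ∧ C.mulVec c = 0 ∧ C * D = 1 ∧ B = joinMatrix c * D

/-- The image of the rational joint image map
`(h, α) ↦ (ν(Ĉ₁)ᵀ ν(Ĥ(h))ᵀ α, …, ν(Ĉₙ)ᵀ ν(Ĥ(h))ᵀ α)` from `(ℙ³)* × ℙ⁵` to `(ℙ⁵)ⁿ`: its values
at all `(h, α)` at which every coordinate vector is nonzero. -/
def jointImage {n : ℕ} (C : Fin n → Matrix (Fin 3) (Fin 4) ℂ) : Set (Fin n → ConicSpace) :=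
  {p | ∃ (h : Fin 4 → ℂ) (α : ConicVec), h ≠ 0 ∧ α ≠ 0 ∧
    ∀ i, ∃ B, IsBackProjection (C i) B ∧
      ∃ hne : (veroneseMatrix B).transpose.mulVec (chowForm h α) ≠ 0,
        p i = Projectivization.mk ℂ ((veroneseMatrix B).transpose.mulVec (chowForm h α)) hne}

/-! ### Zariski closure and defining ideals in `(ℙ⁵)ⁿ` -/

/-- The coordinate ring of `(ℙ⁵)ⁿ`: the variable `(i, s)` is the coefficient at the monomial `s`
of the `i`-th conic. -/
abbrev CoordRing (n : ℕ) : Type := MvPolynomial (Fin n × Sym2 (Fin 3)) ℂ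

/-- `f` is homogeneous in each of the `n` groups of variables. -/
def IsMultihomogeneous {n : ℕ} (f : CoordRing n) : Prop :=
  ∃ d : Fin n → ℕ,
    f.IsWeightedHomogeneous (fun x : Fin n × Sym2 (Fin 3) => (Pi.single x.1 1 : Fin n → ℕ)) d

/-- `f` vanishes at all vectors of homogeneous coordinates of `p`. -/
def VanishesAt {n : ℕ} (f : CoordRing n) (p : Fin n → ConicSpace) : Prop :=
  ∀ v : Fin n → ConicVec, (∀ i, ∃ hv : v i ≠ 0, Projectivization.mk ℂ (v i) hv = p i) →
    MvPolynomial.eval (fun x => v x.1 x.2) f = 0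

/-- The Zariski closure in `(ℙ⁵)ⁿ`: the common zeros of all multihomogeneous polynomials that
vanish on `S`. -/
def zariskiClosure {n : ℕ} (S : Set (Fin n → ConicSpace)) : Set (Fin n → ConicSpace) :=
  {p | ∀ f : CoordRing n, IsMultihomogeneous f → (∀ q ∈ S, VanishesAt f q) → VanishesAt f p}

/-- The defining ideal of `S`: all polynomials that vanish on `S`. -/
def definingIdeal {n : ℕ} (S : Set (Fin n → ConicSpace)) : Ideal (CoordRing n) where
  carrier := {f | ∀ p ∈ S, VanishesAt f p}
  add_mem' := fun hf hg p hp v hv => by rw [map_add, hf p hp v hv, hg p hp v hv, add_zero]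
  zero_mem' := fun _ _ _ _ => map_zero _
  smul_mem' := fun g f hf p hp v hv => by
    rw [smul_eq_mul, map_mul, hf p hp v hv, mul_zero]

/-- The conic multiview variety of the camera arrangement `C`. -/
def conicMultiviewVariety {n : ℕ} (C : Fin n → Matrix (Fin 3) (Fin 4) ℂ) :
    Set (Fin n → ConicSpace) :=
  zariskiClosure (jointImage C)

/-! ### The two-view arrangement and its equations -/

/-- The camera `[0 I]`. -/
def camera₁ : Matrix (Fin 3) (Fin 4) ℂ :=
  !![0, 1, 0, 0;
     0, 0, 1, 0;
     0, 0, 0, 1]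

/-- The camera `[I 0]`. -/
def camera₂ : Matrix (Fin 3) (Fin 4) ℂ :=
  !![1, 0, 0, 0;
     0, 1, 0, 0;
     0, 0, 1, 0]

/-- The `2 × 3` matrix of quadrics in the coefficients `γ₀, …, γ₅` and `δ₀, …, δ₅`. -/
def twoViewMatrix {R : Type*} [CommRing R] (γ δ : Fin 6 → R) : Matrix (Fin 2) (Fin 3) R :=
  !![γ 4 ^ 2 - 4 * γ 3 * γ 5, γ 2 * γ 4 - 2 * γ 1 * γ 5, γ 2 ^ 2 - 4 * γ 0 * γ 5;
     δ 2 ^ 2 - 4 * δ 0 * δ 5, δ 1 * δ 2 - 2 * δ 0 * δ 4, δ 1 ^ 2 - 4 * δ 0 * δ 3]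

/-- The ideal generated by the `2 × 2` minors of a matrix. -/
def minorsIdeal {R : Type*} [CommRing R] {m n : ℕ} (M : Matrix (Fin m) (Fin n) R) : Ideal R :=
  Ideal.span {f | ∃ (r : Fin 2 → Fin m) (c : Fin 2 → Fin n),
    StrictMono r ∧ StrictMono c ∧ f = (M.submatrix r c).det}

end ConicMultiview

/-! A plane through both camera centers meets each image in a line through the epipole, here (0:0:1)
in the first image and (1:0:0) in the second. It is tangent to a space conic exactly when these two
lines are tangent to the images of the conic. The tangent lines from the epipoles are the roots of
the discriminants of γ in x₂ and of δ in x₀. Both are binary quadratic forms on the pencil of planes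
through the centers, so for two views of one conic they are proportional (`dDisc_smul_secondView`).
Conversely, if γ₅, δ₀ ≠ 0 and the discriminants are proportional by a nonzero factor, a plane can be
solved for (`exists_eq_smul_secondView`).

The algebraic core is `mem_discIdeal_of_eval_eq_zero`: a polynomial f vanishing at all parametrized
pairs lies in the ideal of minors. After inverting γ₅ and δ₀, the six entries of the matrix replace
γ₃, γ₁, γ₀, δ₅, δ₄, δ₃ as coordinates, so a multiple of f comes from a polynomial F for a generic 2
× 3 matrix. Inverting γ₃ also, δ₃ and δ₄ are eliminated modulo the generic minors, and what remains
of F vanishes on a dense set, hence is zero. The inverted variables can be cancelled because they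
are not zero divisors modulo the minors. This is `mem_rowMinors_of_mul_mem`, which rests on the
Hilbert–Burch description of the syzygies of the minors.

Hence the ideal of minors is the kernel of a homomorphism into a domain, so it is prime, and it is
the vanishing ideal of the joint image. The description of the variety by rank follows. -/

namespace ConicMultiview

open MvPolynomial

/-! ### The ideal of minors of a `2 × 3` matrix -/

section Minors

variable {R : Type*} [CommRing R]

/-- The ideal generated by the `2 × 2` minors of the matrix with rows `r` and `r'`. -/
def rowMinors (r r' : Fin 3 → R) : Ideal R :=
  Ideal.span {r 0 * r' 1 - r 1 * r' 0, r 0 * r' 2 - r 2 * r' 0, r 1 * r' 2 - r 2 * r' 1}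

theorem mem_rowMinors {r r' : Fin 3 → R} {f : R} :
    f ∈ rowMinors r r' ↔ ∃ u v w, f = u * (r 1 * r' 2 - r 2 * r' 1) -
      v * (r 0 * r' 2 - r 2 * r' 0) + w * (r 0 * r' 1 - r 1 * r' 0) := by
  simp only [rowMinors, Ideal.mem_span_insert, Ideal.mem_span_singleton']
  constructor
  · rintro ⟨w, _, ⟨v, _, ⟨u, rfl⟩, rfl⟩, rfl⟩
    exact ⟨u, -v, w, by ring⟩
  · rintro ⟨u, v, w, rfl⟩
    exact ⟨w, _, ⟨-v, _, ⟨u, rfl⟩, rfl⟩, by ring⟩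

theorem minorsIdeal_eq_rowMinors (M : Matrix (Fin 2) (Fin 3) R) :
    minorsIdeal M = rowMinors (M 0) (M 1) := by
  apply le_antisymm
  · rw [minorsIdeal, Ideal.span_le]
    rintro f ⟨r, c, hr, hc, rfl⟩
    have hr' : r 0 < r 1 := hr (by decide)
    have hc' : c 0 < c 1 := hc (by decide)
    have hr0 : r 0 = 0 := by omega
    have hr1 : r 1 = 1 := by omega
    have hcc : (c 0 = 0 ∧ c 1 = 1) ∨ (c 0 = 0 ∧ c 1 = 2) ∨ (c 0 = 1 ∧ c 1 = 2) := by omega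
    rw [Matrix.det_fin_two]
    simp only [Matrix.submatrix_apply, hr0, hr1]
    apply Ideal.subset_span
    rcases hcc with ⟨h0, h1⟩ | ⟨h0, h1⟩ | ⟨h0, h1⟩ <;> simp [h0, h1]
  · rw [rowMinors, Ideal.span_le]
    rintro f (rfl | rfl | rfl) <;> apply Ideal.subset_span
    · exact ⟨![0, 1], ![0, 1], by decide, by decide, by rw [Matrix.det_fin_two]; simp⟩
    · exact ⟨![0, 1], ![0, 2], by decide, by decide, by rw [Matrix.det_fin_two]; simp⟩
    · exact ⟨![0, 1], ![1, 2], by decide, by decide, by rw [Matrix.det_fin_two]; simp⟩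

theorem map_mem_rowMinors {S F : Type*} [CommRing S] [FunLike F R S] [RingHomClass F R S]
    (φ : F) {r r' : Fin 3 → R} {s s' : Fin 3 → S} (hs : ∀ i, φ (r i) = s i)
    (hs' : ∀ i, φ (r' i) = s' i) {f : R} (hf : f ∈ rowMinors r r') : φ f ∈ rowMinors s s' := by
  obtain ⟨u, v, w, rfl⟩ := mem_rowMinors.1 hf
  exact mem_rowMinors.2 ⟨φ u, φ v, φ w, by simp [hs, hs']⟩

/-- If two of the maximal minors of a `2 × 3` matrix are relatively prime, then the syzygies of the
minors are generated by the rows. -/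
theorem exists_row_combination [IsDomain R] [DecompositionMonoid R] {r r' : Fin 3 → R}
    (hrel : IsRelPrime (r 0 * r' 1 - r 1 * r' 0) (r 1 * r' 2 - r 2 * r' 1))
    (hne : r 0 * r' 1 - r 1 * r' 0 ≠ 0) {u v w : R}
    (h : u * (r 1 * r' 2 - r 2 * r' 1) - v * (r 0 * r' 2 - r 2 * r' 0) +
      w * (r 0 * r' 1 - r 1 * r' 0) = 0) :
    ∃ s t, u = s * r 0 + t * r' 0 ∧ v = s * r 1 + t * r' 1 ∧ w = s * r 2 + t * r' 2 := by
  -- Cramer's rule for the first two equations in `s`, `t`: the syzygy shows that the minor of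
  -- columns 0, 1 divides each numerator times the minor of columns 1, 2, and coprimality removes
  -- the latter.
  obtain ⟨s, hs⟩ : r 0 * r' 1 - r 1 * r' 0 ∣ u * r' 1 - v * r' 0 :=
    hrel.dvd_of_dvd_mul_left ⟨v * r' 2 - w * r' 1, by linear_combination r' 1 * h⟩
  obtain ⟨t, ht⟩ : r 0 * r' 1 - r 1 * r' 0 ∣ r 0 * v - r 1 * u :=
    hrel.dvd_of_dvd_mul_left ⟨r 1 * w - r 2 * v, by linear_combination (-r 1) * h⟩
  refine ⟨s, t, mul_left_cancel₀ hne ?_, mul_left_cancel₀ hne ?_, mul_left_cancel₀ hne ?_⟩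
  · linear_combination r 0 * hs + r' 0 * ht
  · linear_combination r 1 * hs + r' 1 * ht
  · linear_combination h + r 2 * hs + r' 2 * ht

/-- If, modulo `p`, two of the maximal minors of a `2 × 3` matrix are relatively prime, then `p` is
not a zero divisor modulo the ideal of minors. The reduction modulo `p` is given by an endomorphism
`e`. -/
theorem mem_rowMinors_of_mul_mem [IsDomain R] [DecompositionMonoid R] (e : R →+* R) {p : R}
    (hp : p ≠ 0) (hep : e p = 0) (he : ∀ f, p ∣ f - e f) {r r' : Fin 3 → R}
    (hrel : IsRelPrime (e (r 0 * r' 1 - r 1 * r' 0)) (e (r 1 * r' 2 - r 2 * r' 1)))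
    (hne : e (r 0 * r' 1 - r 1 * r' 0) ≠ 0) {f : R} (hf : p * f ∈ rowMinors r r') :
    f ∈ rowMinors r r' := by
  obtain ⟨u, v, w, hf⟩ := mem_rowMinors.1 hf
  -- Modulo `p`, the coefficients `u, v, w` form a syzygy of the reduced minors, hence a combination
  -- of the reduced rows.
  have h := congrArg e hf
  rw [map_mul, hep, zero_mul] at h
  simp only [map_mul, map_sub, map_add] at h hrel hne
  obtain ⟨s, t, hu, hv, hw⟩ :=
    exists_row_combination (r := fun i => e (r i)) (r' := fun i => e (r' i)) hrel hne h.symm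
  have key : ∀ (x : R) (i : Fin 3), e x = s * e (r i) + t * e (r' i) →
      ∃ y, x = s * r i + t * r' i + p * y := by
    intro x i hx
    obtain ⟨y₁, h₁⟩ := he x
    obtain ⟨y₂, h₂⟩ := he (r i)
    obtain ⟨y₃, h₃⟩ := he (r' i)
    exact ⟨y₁ - s * y₂ - t * y₃, by linear_combination h₁ + hx - s * h₂ - t * h₃⟩
  obtain ⟨u', rfl⟩ := key u 0 hu
  obtain ⟨v', rfl⟩ := key v 1 hv
  obtain ⟨w', rfl⟩ := key w 2 hw
  -- The parts of the coefficients that come from the rows are syzygies and contribute nothing; the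
  -- rest is divisible by `p`.
  exact mem_rowMinors.2 ⟨u', v', w', mul_left_cancel₀ hp (by rw [hf]; ring)⟩

theorem mem_rowMinors_of_pow_mul_mem {p : R} {r r' : Fin 3 → R}
    (hp : ∀ f, p * f ∈ rowMinors r r' → f ∈ rowMinors r r') (k : ℕ) {f : R}
    (hf : p ^ k * f ∈ rowMinors r r') : f ∈ rowMinors r r' := by
  induction k with
  | zero => simpa using hf
  | succ k ih => exact ih (hp _ (by rwa [pow_succ', mul_assoc] at hf))

end Minors

/-! ### Irreducibility and relative primality -/

section RelPrime

variable {σ K : Type*} [Field K]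

/-- An irreducible `f` can only fail to be prime to `g` by dividing it, so one zero of `f` outside
the zeros of `g` is a certificate. -/
theorem isRelPrime_of_eval {f g : MvPolynomial σ K} (hf : Irreducible f) (x : σ → K)
    (h0 : eval x f = 0) (h1 : eval x g ≠ 0) : IsRelPrime f g := by
  rw [hf.isRelPrime_iff_not_dvd]
  rintro ⟨q, rfl⟩
  simp [h0] at h1

theorem ne_zero_of_eval {f : MvPolynomial σ K} (x : σ → K) (h : eval x f ≠ 0) : f ≠ 0 := by
  rintro rfl
  simp at h

theorem irreducible_X (i : σ) : Irreducible (X i : MvPolynomial σ K) := by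
  simpa using irreducible_mul_X_add (1 : MvPolynomial σ K) 0 i one_ne_zero (by simp) (by simp)
    isRelPrime_one_left

end RelPrime

/-! ### Setting a variable to zero -/

section Kill

variable {σ K : Type*} [DecidableEq σ] [Field K]

/-- The substitution of zero for the variable `i`. -/
noncomputable def kill (i : σ) : MvPolynomial σ K →ₐ[K] MvPolynomial σ K :=
  aeval fun j => if j = i then 0 else X j

@[simp]
theorem kill_X (i j : σ) : kill (K := K) i (X j) = if j = i then 0 else X j :=
  aeval_X _ _

@[simp]
theorem kill_ofNat (i : σ) (n : ℕ) [n.AtLeastTwo] :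
    kill (K := K) i ofNat(n) = ofNat(n) :=
  map_ofNat _ n

theorem X_dvd_sub_kill (i : σ) (f : MvPolynomial σ K) : X i ∣ f - kill i f := by
  induction f using MvPolynomial.induction_on with
  | C a => simp [kill]
  | add f g hf hg => simpa [add_sub_add_comm] using dvd_add hf hg
  | mul_X f j hf =>
    rw [map_mul, kill_X]
    split_ifs with h
    · simp [h]
    · rw [← sub_mul]
      exact hf.mul_right _

theorem notMem_vars_of_kill_eq {i : σ} {f : MvPolynomial σ K} (h : kill i f = f) :
    i ∉ f.vars := by
  intro hi
  rw [← h, kill, aeval_eq_bind₁] at hi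
  obtain ⟨j, -, hj⟩ := Finset.mem_biUnion.1 (vars_bind₁ _ f hi)
  split_ifs at hj with hji
  · simp at hj
  · rw [vars_X, Finset.mem_singleton] at hj
    exact hji hj.symm

/-- Setting the variable to zero tests that the coefficients are free of it; a linear polynomial
with relatively prime coefficients is irreducible. -/
theorem irreducible_mul_X_add_of_kill {f g : MvPolynomial σ K} (i : σ) (hf0 : f ≠ 0)
    (hf : kill i f = f) (hg : kill i g = g) (h : IsRelPrime f g) : Irreducible (f * X i + g) :=
  irreducible_mul_X_add f g i hf0 (notMem_vars_of_kill_eq hf) (notMem_vars_of_kill_eq hg) h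

end Kill

/-! ### Coordinates on pairs of conics -/

/-- The position of a monomial in the list `mon`. -/
def monIdx : Sym2 (Fin 3) → Fin 6 :=
  Sym2.lift ⟨fun i j => ![![0, 1, 2], ![1, 3, 4], ![2, 4, 5]] i j, by decide⟩

@[simp]
theorem monIdx_mon (k : Fin 6) : monIdx (mon k) = k := by
  revert k; decide

@[simp]
theorem mon_monIdx (s : Sym2 (Fin 3)) : mon (monIdx s) = s := by
  revert s; decide

/-- The numbering `mon` of the monomials, as a bijection. -/
def monEquiv : Fin 6 ≃ Sym2 (Fin 3) where
  toFun := mon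
  invFun := monIdx
  left_inv := monIdx_mon
  right_inv := mon_monIdx

theorem mon_injective : Function.Injective mon := monEquiv.injective

/-- The family of coordinates of a pair of conics. -/
def pairPoint {R : Type*} (γ δ : Fin 6 → R) (x : Fin 2 × Sym2 (Fin 3)) : R :=
  ![γ, δ] x.1 (monIdx x.2)

@[simp]
theorem pairPoint_zero {R : Type*} (γ δ : Fin 6 → R) (k : Fin 6) :
    pairPoint γ δ (0, mon k) = γ k := by
  simp [pairPoint]

@[simp]
theorem pairPoint_one {R : Type*} (γ δ : Fin 6 → R) (k : Fin 6) :
    pairPoint γ δ (1, mon k) = δ k := by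
  simp [pairPoint]

theorem pairPoint_coords {R : Type*} (x : Fin 2 × Sym2 (Fin 3) → R) :
    pairPoint (fun k => x (0, mon k)) (fun k => x (1, mon k)) = x := by
  funext ⟨i, s⟩
  fin_cases i <;> simp [pairPoint]

/-- The `k`-th coordinate of the first conic. -/
noncomputable def gVar (k : Fin 6) : CoordRing 2 := X (0, mon k)

/-- The `k`-th coordinate of the second conic. -/
noncomputable def dVar (k : Fin 6) : CoordRing 2 := X (1, mon k)

@[simp]
theorem eval_gVar (γ δ : Fin 6 → ℂ) (k : Fin 6) : eval (pairPoint γ δ) (gVar k) = γ k := by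
  simp [gVar]

@[simp]
theorem eval_dVar (γ δ : Fin 6 → ℂ) (k : Fin 6) : eval (pairPoint γ δ) (dVar k) = δ k := by
  simp [dVar]

@[simp]
theorem aeval_gVar {A : Type*} [CommRing A] [Algebra ℂ A] (γ δ : Fin 6 → A) (k : Fin 6) :
    aeval (pairPoint γ δ) (gVar k) = γ k := by
  simp [gVar]

@[simp]
theorem aeval_dVar {A : Type*} [CommRing A] [Algebra ℂ A] (γ δ : Fin 6 → A) (k : Fin 6) :
    aeval (pairPoint γ δ) (dVar k) = δ k := by
  simp [dVar]

@[simp]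
theorem kill_gVar_gVar (j k : Fin 6) :
    kill (0, mon j) (gVar k) = if k = j then 0 else gVar k := by
  simp [gVar, mon_injective.eq_iff]

@[simp]
theorem kill_gVar_dVar (j k : Fin 6) : kill (0, mon j) (dVar k) = dVar k := by
  simp [dVar]

@[simp]
theorem kill_dVar_gVar (j k : Fin 6) : kill (1, mon j) (gVar k) = gVar k := by
  simp [gVar]

@[simp]
theorem kill_dVar_dVar (j k : Fin 6) :
    kill (1, mon j) (dVar k) = if k = j then 0 else dVar k := by
  simp [dVar, mon_injective.eq_iff]

theorem irreducible_gVar (k : Fin 6) : Irreducible (gVar k) := irreducible_X _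

theorem irreducible_dVar (k : Fin 6) : Irreducible (dVar k) := irreducible_X _

theorem coordRing_induction {P : CoordRing 2 → Prop} (hC : ∀ a, P (C a))
    (hadd : ∀ f g, P f → P g → P (f + g)) (hg : ∀ f k, P f → P (f * gVar k))
    (hd : ∀ f k, P f → P (f * dVar k)) (f : CoordRing 2) : P f := by
  induction f using MvPolynomial.induction_on with
  | C a => exact hC a
  | add f g hf hg => exact hadd f g hf hg
  | mul_X f x hf =>
    obtain ⟨i, s⟩ := x
    rw [← mon_monIdx s]
    fin_cases i
    · exact hg f _ hf
    · exact hd f _ hf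

theorem eq_of_eval_pairPoint {f g : CoordRing 2}
    (h : ∀ γ δ, eval (pairPoint γ δ) f = eval (pairPoint γ δ) g) : f = g :=
  MvPolynomial.funext fun x => by rw [← pairPoint_coords x]; exact h _ _

/-! ### Variables that are not zero divisors modulo ideals of minors -/

/-- The discriminant of the conic `γ` as a quadratic form in `x₂`, in the basis
`x₁², 2x₀x₁, x₀²`. -/
def gDisc {R : Type*} [CommRing R] (γ : Fin 6 → R) : Fin 3 → R :=
  ![γ 4 ^ 2 - 4 * γ 3 * γ 5, γ 2 * γ 4 - 2 * γ 1 * γ 5, γ 2 ^ 2 - 4 * γ 0 * γ 5]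

/-- The discriminant of the conic `δ` as a quadratic form in `x₀`, in the basis
`x₂², 2x₁x₂, x₁²`. -/
def dDisc {R : Type*} [CommRing R] (δ : Fin 6 → R) : Fin 3 → R :=
  ![δ 2 ^ 2 - 4 * δ 0 * δ 5, δ 1 * δ 2 - 2 * δ 0 * δ 4, δ 1 ^ 2 - 4 * δ 0 * δ 3]

/-- The ideal of minors of the matrix of discriminants. -/
noncomputable def discIdeal : Ideal (CoordRing 2) := rowMinors (gDisc gVar) (dDisc dVar)

theorem minorsIdeal_twoViewMatrix {R : Type*} [CommRing R] (γ δ : Fin 6 → R) :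
    minorsIdeal (twoViewMatrix γ δ) = rowMinors (gDisc γ) (dDisc δ) :=
  minorsIdeal_eq_rowMinors _

theorem IsRelPrime.neg_two_mul {f g : CoordRing 2} (h : IsRelPrime f g) :
    IsRelPrime (-2 * f) g := by
  refine h.of_dvd_left ⟨C (-1 / 2), ?_⟩
  have : (C (-1 / 2) : CoordRing 2) * (-2) = 1 := by
    rw [show (-2 : CoordRing 2) = C (-2) by rw [C_neg, map_ofNat], ← C_mul]
    norm_num
  linear_combination (-f) * this

/-- Linear in γ₁, with coefficients -2γ₅ and γ₂γ₄. -/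
theorem irreducible_gDisc_one : Irreducible (gVar 2 * gVar 4 - 2 * gVar 1 * gVar 5) := by
  have h := irreducible_mul_X_add_of_kill (0, mon 1) (f := -2 * gVar 5) (g := gVar 2 * gVar 4)
    (ne_zero_of_eval (pairPoint (fun _ => 1) fun _ => 1) (by simp)) (by simp) (by simp)
    (IsRelPrime.neg_two_mul (isRelPrime_of_eval (irreducible_gVar 5)
      (pairPoint ![0, 0, 1, 0, 1, 0] 0) (by simp) (by simp)))
  convert h using 1
  rw [← gVar]
  ring

theorem irreducible_dDisc_one : Irreducible (dVar 1 * dVar 2 - 2 * dVar 0 * dVar 4) := by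
  have h := irreducible_mul_X_add_of_kill (1, mon 4) (f := -2 * dVar 0) (g := dVar 1 * dVar 2)
    (ne_zero_of_eval (pairPoint (fun _ => 1) fun _ => 1) (by simp)) (by simp) (by simp)
    (IsRelPrime.neg_two_mul (isRelPrime_of_eval (irreducible_dVar 0)
      (pairPoint 0 ![0, 1, 1, 0, 0, 0]) (by simp) (by simp)))
  convert h using 1
  rw [← dVar]
  ring

/-- At γ₅ = 0 the first row becomes (γ₄², γ₂γ₄, γ₂²). The minor of columns 0, 1 then splits into γ₄
and a factor linear in γ₄, both irreducible and neither dividing the minor of columns 1, 2. -/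
theorem mem_discIdeal_of_gVar_five_mul {f : CoordRing 2} (hf : gVar 5 * f ∈ discIdeal) :
    f ∈ discIdeal := by
  have hirr : Irreducible ((dVar 1 * dVar 2 - 2 * dVar 0 * dVar 4) * gVar 4 +
      -(gVar 2 * (dVar 2 ^ 2 - 4 * dVar 0 * dVar 5))) :=
    irreducible_mul_X_add_of_kill (0, mon 4) irreducible_dDisc_one.ne_zero (by simp) (by simp)
      (isRelPrime_of_eval irreducible_dDisc_one (pairPoint ![0, 0, 1, 0, 0, 0] ![0, 0, 1, 0, 0, 0])
        (by simp) (by simp))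
  refine mem_rowMinors_of_mul_mem (kill (0, mon 5)).toRingHom (irreducible_gVar 5).ne_zero
    (by simp) (X_dvd_sub_kill _) ?_ (ne_zero_of_eval
      (pairPoint ![0, 0, 0, 0, 1, 0] ![0, 1, 1, 0, 0, 0]) (by simp [gDisc, dDisc])) hf
  have h1 : kill (0, mon 5) (gDisc gVar 0 * dDisc dVar 1 - gDisc gVar 1 * dDisc dVar 0) =
      gVar 4 * ((dVar 1 * dVar 2 - 2 * dVar 0 * dVar 4) * gVar 4 +
      -(gVar 2 * (dVar 2 ^ 2 - 4 * dVar 0 * dVar 5))) := by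
    simp [gDisc, dDisc]
    ring
  have h2 : kill (0, mon 5) (gDisc gVar 1 * dDisc dVar 2 - gDisc gVar 2 * dDisc dVar 1) =
      gVar 2 * gVar 4 * (dVar 1 ^ 2 - 4 * dVar 0 * dVar 3) -
      gVar 2 ^ 2 * (dVar 1 * dVar 2 - 2 * dVar 0 * dVar 4) := by
    simp [gDisc, dDisc]
  change IsRelPrime (kill (0, mon 5) _) (kill (0, mon 5) _)
  rw [h1, h2]
  refine IsRelPrime.mul_left ?_ ?_
  · exact isRelPrime_of_eval (irreducible_gVar 4)
      (pairPoint ![0, 0, 1, 0, 0, 0] ![0, 1, 1, 0, 0, 0]) (by simp) (by simp)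
  · exact isRelPrime_of_eval hirr
      (pairPoint ![0, 0, 1, 0, 1, 0] ![0, 1, 0, 0, 0, 0]) (by simp) (by simp)

/-- The mirror image: at δ₀ = 0 the second row becomes (δ₂², δ₁δ₂, δ₁²), and now the minor of
columns 1, 2 splits, into δ₁ and a factor linear in δ₁. -/
theorem mem_discIdeal_of_dVar_zero_mul {f : CoordRing 2} (hf : dVar 0 * f ∈ discIdeal) :
    f ∈ discIdeal := by
  have hirr : Irreducible ((gVar 2 * gVar 4 - 2 * gVar 1 * gVar 5) * dVar 1 +
      -(dVar 2 * (gVar 2 ^ 2 - 4 * gVar 0 * gVar 5))) :=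
    irreducible_mul_X_add_of_kill (1, mon 1) irreducible_gDisc_one.ne_zero (by simp) (by simp)
      (isRelPrime_of_eval irreducible_gDisc_one (pairPoint ![0, 0, 1, 0, 0, 0] ![0, 0, 1, 0, 0, 0])
        (by simp) (by simp))
  refine mem_rowMinors_of_mul_mem (kill (1, mon 0)).toRingHom (irreducible_dVar 0).ne_zero
    (by simp) (X_dvd_sub_kill _) ?_ (ne_zero_of_eval
      (pairPoint ![0, 0, 1, 0, 1, 0] ![0, 0, 1, 0, 0, 0]) (by simp [gDisc, dDisc])) hf
  have h1 : kill (1, mon 0) (gDisc gVar 1 * dDisc dVar 2 - gDisc gVar 2 * dDisc dVar 1) =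
      dVar 1 * ((gVar 2 * gVar 4 - 2 * gVar 1 * gVar 5) * dVar 1 +
      -(dVar 2 * (gVar 2 ^ 2 - 4 * gVar 0 * gVar 5))) := by
    simp [gDisc, dDisc]
    ring
  have h2 : kill (1, mon 0) (gDisc gVar 0 * dDisc dVar 1 - gDisc gVar 1 * dDisc dVar 0) =
      (gVar 4 ^ 2 - 4 * gVar 3 * gVar 5) * (dVar 1 * dVar 2) -
      (gVar 2 * gVar 4 - 2 * gVar 1 * gVar 5) * dVar 2 ^ 2 := by
    simp [gDisc, dDisc]
  change IsRelPrime (kill (1, mon 0) _) (kill (1, mon 0) _)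
  rw [h1, h2]
  refine (IsRelPrime.mul_left ?_ ?_).symm
  · exact isRelPrime_of_eval (irreducible_dVar 1)
      (pairPoint ![0, 0, 1, 0, 1, 0] ![0, 0, 1, 0, 0, 0]) (by simp) (by simp)
  · exact isRelPrime_of_eval hirr
      (pairPoint ![0, 0, 0, 0, 1, 0] ![0, 1, 1, 0, 0, 0]) (by simp) (by simp)

/-- The ideal of minors of a matrix of distinct variables. -/
noncomputable def genericIdeal : Ideal (CoordRing 2) :=
  rowMinors ![gVar 3, gVar 1, gVar 0] ![dVar 5, dVar 4, dVar 3]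

/-- At γ₃ = 0 the first minor becomes -γ₁δ₅, and neither variable divides γ₁δ₃ - γ₀δ₄. -/
theorem mem_genericIdeal_of_gVar_three_mul {f : CoordRing 2} (hf : gVar 3 * f ∈ genericIdeal) :
    f ∈ genericIdeal := by
  refine mem_rowMinors_of_mul_mem (kill (0, mon 3)).toRingHom (irreducible_gVar 3).ne_zero
    (by simp) (X_dvd_sub_kill _) ?_ (ne_zero_of_eval
      (pairPoint ![0, 1, 0, 0, 0, 0] ![0, 0, 0, 0, 0, 1]) (by simp)) hf
  have h1 : kill (0, mon 3) (gVar 3 * dVar 4 - gVar 1 * dVar 5) = -gVar 1 * dVar 5 := by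
    simp
  have h2 : kill (0, mon 3) (gVar 1 * dVar 3 - gVar 0 * dVar 4) =
      gVar 1 * dVar 3 - gVar 0 * dVar 4 := by
    simp
  change IsRelPrime (kill (0, mon 3) (gVar 3 * dVar 4 - gVar 1 * dVar 5))
    (kill (0, mon 3) (gVar 1 * dVar 3 - gVar 0 * dVar 4))
  rw [h1, h2]
  refine IsRelPrime.mul_left (IsRelPrime.neg_left ?_) ?_
  · exact isRelPrime_of_eval (irreducible_gVar 1)
      (pairPoint ![1, 0, 0, 0, 0, 0] ![0, 0, 0, 0, 1, 0]) (by simp) (by simp)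
  · exact isRelPrime_of_eval (irreducible_dVar 5)
      (pairPoint ![0, 1, 0, 0, 0, 0] ![0, 0, 0, 1, 0, 0]) (by simp) (by simp)

/-! ### Substitutions -/

/-- The substitution of `γ` and `δ` for the coordinates of a pair of conics. -/
noncomputable def pairSubst (γ δ : Fin 6 → CoordRing 2) : CoordRing 2 →ₐ[ℂ] CoordRing 2 :=
  aeval (pairPoint γ δ)

@[simp]
theorem pairSubst_gVar (γ δ : Fin 6 → CoordRing 2) (k : Fin 6) :
    pairSubst γ δ (gVar k) = γ k :=
  aeval_gVar γ δ k

@[simp]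
theorem pairSubst_dVar (γ δ : Fin 6 → CoordRing 2) (k : Fin 6) :
    pairSubst γ δ (dVar k) = δ k :=
  aeval_dVar γ δ k

@[simp]
theorem pairSubst_ofNat (γ δ : Fin 6 → CoordRing 2) (n : ℕ) [n.AtLeastTwo] :
    pairSubst γ δ ofNat(n) = ofNat(n) :=
  map_ofNat _ n

@[simp]
theorem pairSubst_C (γ δ : Fin 6 → CoordRing 2) (a : ℂ) : pairSubst γ δ (C a) = C a :=
  algHom_C _ a

theorem eval_pairSubst (G D : Fin 6 → CoordRing 2) (γ δ : Fin 6 → ℂ) (F : CoordRing 2) :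
    eval (pairPoint γ δ) (pairSubst G D F) =
      eval (pairPoint (fun k => eval (pairPoint γ δ) (G k))
        fun k => eval (pairPoint γ δ) (D k)) F := by
  induction F using coordRing_induction with
  | hC a => simp
  | hadd f g hf hg => simp [hf, hg]
  | hg f k hf => simp [hf]
  | hd f k hf => simp [hf]

/-! ### The parametrization and the ideal of minors -/

/-- The coefficients of the quadratic form `q(-h₃ y₁, -h₃ y₂, h₀ y₀ + h₁ y₁ + h₂ y₂)` in `y`, where
`q` is the quadratic form with coefficients `γ`. -/
def secondView {R : Type*} [CommRing R] (γ : Fin 6 → R) (h : Fin 4 → R) : Fin 6 → R :=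
  ![γ 5 * h 0 ^ 2,
    2 * γ 5 * h 0 * h 1 - γ 2 * h 0 * h 3,
    2 * γ 5 * h 0 * h 2 - γ 4 * h 0 * h 3,
    γ 0 * h 3 ^ 2 - γ 2 * h 1 * h 3 + γ 5 * h 1 ^ 2,
    γ 1 * h 3 ^ 2 - γ 2 * h 2 * h 3 - γ 4 * h 1 * h 3 + 2 * γ 5 * h 1 * h 2,
    γ 3 * h 3 ^ 2 - γ 4 * h 2 * h 3 + γ 5 * h 2 ^ 2]

/-- The discriminants of both views of a conic are proportional. -/
theorem dDisc_smul_secondView {R : Type*} [CommRing R] (γ : Fin 6 → R) (h : Fin 4 → R) (c : R)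
    (i : Fin 3) : dDisc (c • secondView γ h) i = (c * h 0 * h 3) ^ 2 * gDisc γ i := by
  -- Replacing x₂ by h₀y₀ + h₁y₁ + h₂y₂ multiplies the discriminant by h₀², and scaling the other
  -- two variables by -h₃ multiplies it by h₃².
  fin_cases i <;> simp [dDisc, gDisc, secondView] <;> ring

theorem rowMinors_eq_bot {R : Type*} [CommRing R] {r r' q : Fin 3 → R} {c c' : R}
    (h : ∀ i, r i = c * q i) (h' : ∀ i, r' i = c' * q i) : rowMinors r r' = ⊥ := by
  rw [eq_bot_iff]
  intro f hf
  obtain ⟨u, v, w, rfl⟩ := mem_rowMinors.1 hf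
  simp only [h, h', Ideal.mem_bot]
  ring

/-- Surjectivity of φ modulo `J` after inverting `p` needs checking on the variables only; since `p`
itself is a value of φ, denominators can be equalized. -/
theorem exists_pow_mul_sub_mem (J : Ideal (CoordRing 2)) (φ : CoordRing 2 →ₐ[ℂ] CoordRing 2)
    {p p' : CoordRing 2} (hp : φ p' = p) (hg : ∀ k, ∃ G, p * gVar k - φ G ∈ J)
    (hd : ∀ k, ∃ G, p * dVar k - φ G ∈ J) (f : CoordRing 2) :
    ∃ k F, p ^ k * f - φ F ∈ J := by
  have hmul : ∀ f x : CoordRing 2, (∃ k F, p ^ k * f - φ F ∈ J) → (∃ G, p * x - φ G ∈ J) →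
      ∃ k F, p ^ k * (f * x) - φ F ∈ J := by
    rintro f x ⟨k, F, hF⟩ ⟨G, hG⟩
    refine ⟨k + 1, F * G, ?_⟩
    have := J.add_mem (J.mul_mem_left (p ^ k * f) hG) (J.mul_mem_left (φ G) hF)
    convert this using 1
    rw [map_mul]
    ring
  induction f using coordRing_induction with
  | hC a => exact ⟨0, C a, by simp [algHom_C]⟩
  | hadd f g hf hg =>
    obtain ⟨k, F, hF⟩ := hf
    obtain ⟨l, G, hG⟩ := hg
    refine ⟨k + l, p' ^ l * F + p' ^ k * G, ?_⟩
    have := J.add_mem (J.mul_mem_left (p ^ l) hF) (J.mul_mem_left (p ^ k) hG)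
    convert this using 1
    simp only [map_add, map_mul, map_pow, hp]
    ring
  | hg f k hf => exact hmul f _ hf (hg k)
  | hd f k hf => exact hmul f _ hf (hd k)

/-- The substitution of the entries of the matrix of discriminants for the variables
`γ₃, γ₁, γ₀` and `δ₅, δ₄, δ₃`. -/
noncomputable def discSubst : CoordRing 2 →ₐ[ℂ] CoordRing 2 :=
  pairSubst ![gDisc gVar 2, gDisc gVar 1, gVar 2, gDisc gVar 0, gVar 4, gVar 5]
    ![dVar 0, dVar 1, dVar 2, dDisc dVar 2, dDisc dVar 1, dDisc dVar 0]

/-- Each entry of the matrix is linear in one of γ₃, γ₁, γ₀ (or δ₅, δ₄, δ₃) with coefficient a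
constant times γ₅ (or δ₀), so it can be solved for that variable. -/
theorem exists_pow_mul_eq_discSubst (f : CoordRing 2) :
    ∃ k F, (gVar 5 * dVar 0) ^ k * f = discSubst F := by
  have h2 : (C 2⁻¹ : CoordRing 2) * 2 = 1 := by
    rw [← map_ofNat (C : ℂ →+* CoordRing 2) 2, ← C_mul]
    norm_num
  have h4 : (C 4⁻¹ : CoordRing 2) * 4 = 1 := by
    rw [← map_ofNat (C : ℂ →+* CoordRing 2) 4, ← C_mul]
    norm_num
  have key := exists_pow_mul_sub_mem ⊥ discSubst (p := gVar 5 * dVar 0) (p' := gVar 5 * dVar 0)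
    (by simp [discSubst]) ?_ ?_ f
  · simpa only [Ideal.mem_bot, sub_eq_zero] using key
  · intro k
    simp only [Ideal.mem_bot]
    fin_cases k
    · refine ⟨C 4⁻¹ * dVar 0 * (gVar 2 ^ 2 - gVar 0), ?_⟩
      simp [discSubst, gDisc]
      linear_combination (- gVar 5 * dVar 0 * gVar 0) * h4
    · refine ⟨C 2⁻¹ * dVar 0 * (gVar 2 * gVar 4 - gVar 1), ?_⟩
      simp [discSubst, gDisc]
      linear_combination (- gVar 5 * dVar 0 * gVar 1) * h2
    · exact ⟨gVar 5 * dVar 0 * gVar 2, by simp [discSubst]⟩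
    · refine ⟨C 4⁻¹ * dVar 0 * (gVar 4 ^ 2 - gVar 3), ?_⟩
      simp [discSubst, gDisc]
      linear_combination (- gVar 5 * dVar 0 * gVar 3) * h4
    · exact ⟨gVar 5 * dVar 0 * gVar 4, by simp [discSubst]⟩
    · exact ⟨gVar 5 * dVar 0 * gVar 5, by simp [discSubst]⟩
  · intro k
    simp only [Ideal.mem_bot]
    fin_cases k
    · exact ⟨gVar 5 * dVar 0 * dVar 0, by simp [discSubst]⟩
    · exact ⟨gVar 5 * dVar 0 * dVar 1, by simp [discSubst]⟩
    · exact ⟨gVar 5 * dVar 0 * dVar 2, by simp [discSubst]⟩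
    · refine ⟨C 4⁻¹ * gVar 5 * (dVar 1 ^ 2 - dVar 3), ?_⟩
      simp [discSubst, dDisc]
      linear_combination (- gVar 5 * dVar 0 * dVar 3) * h4
    · refine ⟨C 2⁻¹ * gVar 5 * (dVar 1 * dVar 2 - dVar 4), ?_⟩
      simp [discSubst, dDisc]
      linear_combination (- gVar 5 * dVar 0 * dVar 4) * h2
    · refine ⟨C 4⁻¹ * gVar 5 * (dVar 2 ^ 2 - dVar 5), ?_⟩
      simp [discSubst, dDisc]
      linear_combination (- gVar 5 * dVar 0 * dVar 5) * h4

theorem discSubst_mem {F : CoordRing 2} (hF : F ∈ genericIdeal) : discSubst F ∈ discIdeal :=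
  map_mem_rowMinors discSubst (by intro i; fin_cases i <;> simp [discSubst])
    (by intro i; fin_cases i <;> simp [discSubst]) hF

/-- The substitution of zero for `δ₃` and `δ₄`. -/
noncomputable def dropSubst : CoordRing 2 →ₐ[ℂ] CoordRing 2 :=
  pairSubst gVar ![dVar 0, dVar 1, dVar 2, 0, 0, dVar 5]

/-- The minors give γ₃δ₃ ≡ γ₀δ₅ and γ₃δ₄ ≡ γ₁δ₅, which eliminates δ₃ and δ₄ once γ₃ is inverted. -/
theorem exists_pow_mul_sub_dropSubst_mem (F : CoordRing 2) :
    ∃ k G, gVar 3 ^ k * F - dropSubst G ∈ genericIdeal := by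
  refine exists_pow_mul_sub_mem genericIdeal dropSubst (p' := gVar 3) (by simp [dropSubst])
    (fun k => ⟨gVar 3 * gVar k, by simp [dropSubst]⟩) (fun k => ?_) F
  have hm : ∀ {a b : CoordRing 2}, a = b → a - b ∈ genericIdeal := fun h => by simp [h]
  fin_cases k
  · exact ⟨gVar 3 * dVar 0, hm (by simp [dropSubst])⟩
  · exact ⟨gVar 3 * dVar 1, hm (by simp [dropSubst])⟩
  · exact ⟨gVar 3 * dVar 2, hm (by simp [dropSubst])⟩
  · exact ⟨gVar 0 * dVar 5, mem_rowMinors.2 ⟨0, -1, 0, by simp [dropSubst]⟩⟩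
  · exact ⟨gVar 1 * dVar 5, mem_rowMinors.2 ⟨0, 0, 1, by simp [dropSubst]⟩⟩
  · exact ⟨gVar 3 * dVar 5, hm (by simp [dropSubst])⟩

theorem eval_discSubst (γ δ : Fin 6 → ℂ) (F : CoordRing 2) :
    eval (pairPoint γ δ) (discSubst F) =
      eval (pairPoint ![gDisc γ 2, gDisc γ 1, γ 2, gDisc γ 0, γ 4, γ 5]
        ![δ 0, δ 1, δ 2, dDisc δ 2, dDisc δ 1, dDisc δ 0]) F := by
  rw [discSubst, eval_pairSubst]
  congr 3 <;> funext k <;> fin_cases k <;> simp [gDisc, dDisc]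

theorem eval_dropSubst (γ δ : Fin 6 → ℂ) (F : CoordRing 2) :
    eval (pairPoint γ δ) (dropSubst F) =
      eval (pairPoint γ ![δ 0, δ 1, δ 2, 0, 0, δ 5]) F := by
  rw [dropSubst, eval_pairSubst]
  congr 3 <;> funext k <;> fin_cases k <;> simp

/-- Pairs of conics with `γ₅ ≠ 0`, `δ₀ ≠ 0` and proportional nonzero discriminants are the two
views of a conic. -/
theorem exists_eq_smul_secondView {γ δ : Fin 6 → ℂ} {t : ℂ} (h5 : γ 5 ≠ 0) (h0 : δ 0 ≠ 0)
    (ht : t ≠ 0) (h : ∀ i, dDisc δ i = t * gDisc γ i) :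
    ∃ (x : Fin 4 → ℂ) (c : ℂ), x 0 ≠ 0 ∧ c ≠ 0 ∧ δ = c • secondView γ x := by
  obtain ⟨s, rfl⟩ := IsAlgClosed.exists_pow_nat_eq t (n := 2) (by norm_num)
  have hs : s ≠ 0 := by
    rintro rfl
    simp at ht
  have e0 := h 0
  have e1 := h 1
  have e2 := h 2
  simp only [dDisc, gDisc, Matrix.cons_val] at e0 e1 e2
  -- With the normalization h₃ = -1 the ratio of discriminants forces (c h₀)² = s²; take c h₀ = s.
  -- The coefficients of y₀², y₀y₁, y₀y₂ then determine h₀, h₁, h₂, and the other three follow from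
  -- the discriminants.
  refine ⟨![δ 0 / (s * γ 5), (δ 1 / s - γ 2) / (2 * γ 5), (δ 2 / s - γ 4) / (2 * γ 5), -1],
    s ^ 2 * γ 5 / δ 0, by simp [hs, h5, h0], by simp [hs, h5, h0], ?_⟩
  funext k
  fin_cases k <;> simp [secondView] <;> field_simp
  · ring
  · ring
  · linear_combination -e2
  · linear_combination -e1
  · linear_combination -e0

theorem mem_discIdeal_of_eval_eq_zero {f : CoordRing 2}
    (hf : ∀ (γ : Fin 6 → ℂ) (x : Fin 4 → ℂ) (c : ℂ), γ 5 ≠ 0 → x 0 ≠ 0 → c ≠ 0 →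
      eval (pairPoint γ (c • secondView γ x)) f = 0) : f ∈ discIdeal := by
  obtain ⟨k, F, hF⟩ := exists_pow_mul_eq_discSubst f
  have hdisc : ∀ g, gVar 5 * dVar 0 * g ∈ discIdeal → g ∈ discIdeal := fun g hg =>
    mem_discIdeal_of_dVar_zero_mul (mem_discIdeal_of_gVar_five_mul (by rwa [← mul_assoc]))
  refine mem_rowMinors_of_pow_mul_mem hdisc k ?_
  change _ ∈ discIdeal
  rw [hF]
  apply discSubst_mem
  obtain ⟨l, G, hG⟩ := exists_pow_mul_sub_dropSubst_mem F
  refine mem_rowMinors_of_pow_mul_mem (fun _ => mem_genericIdeal_of_gVar_three_mul) l ?_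
  change _ ∈ genericIdeal
  -- The extra factor restricts the evaluation to points where these four variables are nonzero.
  suffices h : gVar 3 * gVar 5 * dVar 0 * dVar 5 * dropSubst G = 0 by
    rwa [(mul_eq_zero.1 h).resolve_left (by
      simp [(irreducible_gVar _).ne_zero, (irreducible_dVar _).ne_zero]), sub_zero] at hG
  refine eq_of_eval_pairPoint fun γ δ => ?_
  simp only [map_mul, map_zero, eval_gVar, eval_dVar, mul_eq_zero]
  by_cases h3 : γ 3 = 0
  · simp [h3]
  by_cases h5 : γ 5 = 0
  · simp [h5]
  by_cases h0 : δ 0 = 0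
  · simp [h0]
  by_cases h5' : δ 5 = 0
  · simp [h5']
  right
  set t := δ 5 / γ 3 with ht
  have ht5 : δ 5 = t * γ 3 := (div_mul_cancel₀ _ h3).symm
  have ht0 : t ≠ 0 := div_ne_zero h5' h3
  -- The pair with discriminants (γ₃, γ₁, γ₀) and `t` times that row: the old coordinates are
  -- recovered from the entries of the matrix.
  let γ' : Fin 6 → ℂ := ![(γ 2 ^ 2 - γ 0) / (4 * γ 5), (γ 2 * γ 4 - γ 1) / (2 * γ 5), γ 2,
    (γ 4 ^ 2 - γ 3) / (4 * γ 5), γ 4, γ 5]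
  let δ' : Fin 6 → ℂ := ![δ 0, δ 1, δ 2, (δ 1 ^ 2 - t * γ 0) / (4 * δ 0),
    (δ 1 * δ 2 - t * γ 1) / (2 * δ 0), (δ 2 ^ 2 - t * γ 3) / (4 * δ 0)]
  have hγ' : gDisc γ' = ![γ 3, γ 1, γ 0] := by
    funext i
    fin_cases i <;> simp [gDisc, γ'] <;> field_simp <;> ring
  have hδ' : dDisc δ' = ![t * γ 3, t * γ 1, t * γ 0] := by
    funext i
    fin_cases i <;> simp [dDisc, δ'] <;> field_simp <;> ring
  obtain ⟨x, c, hx, hc, hxc⟩ := exists_eq_smul_secondView (γ := γ') (δ := δ') h5 h0 ht0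
    (by intro i; rw [hγ', hδ']; fin_cases i <;> rfl)
  have hF0 : eval (pairPoint γ' δ') (discSubst F) = 0 := by
    rw [← hF, map_mul, hxc, hf γ' x c h5 hx hc, mul_zero]
  rw [eval_discSubst, hγ', hδ'] at hF0
  have hpt : ![![γ 3, γ 1, γ 0] 2, ![γ 3, γ 1, γ 0] 1, γ' 2, ![γ 3, γ 1, γ 0] 0, γ' 4, γ' 5]
      = γ := by
    funext i
    fin_cases i <;> rfl
  rw [hpt] at hF0
  simp only [Matrix.cons_val] at hF0
  -- At this point the generic matrix has proportional rows, so everything in `genericIdeal`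
  -- vanishes and the zero of `F` passes to `dropSubst G`.
  have hG0 := map_mem_rowMinors (eval (pairPoint γ
    ![δ' 0, δ' 1, δ' 2, t * γ 0, t * γ 1, t * γ 3])) (s := ![γ 3, γ 1, γ 0])
    (s' := ![t * γ 3, t * γ 1, t * γ 0]) (by intro i; fin_cases i <;> simp)
    (by intro i; fin_cases i <;> simp) hG
  rw [rowMinors_eq_bot (c := 1) (c' := t) (fun i => (one_mul _).symm) (by intro i; fin_cases i <;> rfl), Ideal.mem_bot, map_sub,
    map_mul, hF0, mul_zero, zero_sub, neg_eq_zero, eval_dropSubst] at hG0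
  rw [eval_dropSubst, ht5]
  exact hG0

/-- The comorphism of the parametrization of pairs of views of a conic. -/
noncomputable def viewHom : CoordRing 2 →ₐ[ℂ] CoordRing 2 :=
  pairSubst gVar (dVar 4 • secondView gVar ![dVar 0, dVar 1, dVar 2, dVar 3])

theorem eval_viewHom (γ δ : Fin 6 → ℂ) (F : CoordRing 2) :
    eval (pairPoint γ δ) (viewHom F) =
      eval (pairPoint γ (δ 4 • secondView γ ![δ 0, δ 1, δ 2, δ 3])) F := by
  rw [viewHom, eval_pairSubst]
  congr 3 <;> funext k <;> fin_cases k <;> simp [secondView]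

/-- In `viewHom`, δ₀, …, δ₃ play the plane and δ₄ the scale of the second view; δ₅ does not occur in
the image point, hence the arbitrary 0 below. -/
theorem discIdeal_eq_ker : discIdeal = RingHom.ker viewHom := by
  apply le_antisymm
  · intro f hf
    have h := map_mem_rowMinors viewHom (s := gDisc gVar)
      (s' := dDisc (dVar 4 • secondView gVar ![dVar 0, dVar 1, dVar 2, dVar 3]))
      (by intro i; fin_cases i <;> simp [gDisc, viewHom])
      (by intro i; fin_cases i <;> simp [dDisc, viewHom]) hf
    rwa [rowMinors_eq_bot (fun i => (one_mul _).symm) (dDisc_smul_secondView _ _ _), Ideal.mem_bot] at h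
  · intro f hf
    refine mem_discIdeal_of_eval_eq_zero fun γ x c _ _ _ => ?_
    have h := eval_viewHom γ ![x 0, x 1, x 2, x 3, c, 0] f
    rw [(RingHom.mem_ker).1 hf, map_zero] at h
    convert h.symm using 5
    simp only [Matrix.cons_val]
    congr 1
    funext i
    fin_cases i <;> rfl

theorem isPrime_discIdeal : discIdeal.IsPrime := by
  rw [discIdeal_eq_ker]
  exact RingHom.ker_isPrime _

/-! ### The two views of a conic in coordinates -/

theorem veroneseMatrix_mul {l m n : ℕ} (A : Matrix (Fin l) (Fin m) ℂ)
    (B : Matrix (Fin m) (Fin n) ℂ) :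
    veroneseMatrix (A * B) = veroneseMatrix A * veroneseMatrix B := by
  ext s t
  induction s using Sym2.ind with
  | _ i j =>
    have h : ∀ p : Fin m × Fin m, (∑ u, (if s(p.1, p.2) = u then A i p.1 * A j p.2 else 0) *
        veroneseMatrix B u t) = A i p.1 * A j p.2 * veroneseMatrix B s(p.1, p.2) t := by
      intro p
      rw [Finset.sum_eq_single s(p.1, p.2)]
      · simp
      · intro u _ hu
        simp [hu.symm]
      · simp
    rw [Matrix.mul_apply]
    simp only [veroneseMatrix, Sym2.lift_mk] at h ⊢
    simp only [Finset.sum_mul]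
    rw [Finset.sum_comm]
    simp only [h, Finset.mul_sum]
    rw [Finset.sum_comm]
    refine Finset.sum_congr rfl fun q _ => ?_
    split_ifs
    · rw [Matrix.mul_apply, Matrix.mul_apply, Finset.sum_mul_sum, Fintype.sum_prod_type]
      refine Finset.sum_congr rfl fun a _ => Finset.sum_congr rfl fun b _ => by ring
    · simp

/-- Functoriality of ν turns a view into the substitution of a 3 × 3 matrix into α. -/
theorem view_eq (B : Matrix (Fin 6) (Fin 3) ℂ) (h : Fin 4 → ℂ) (α : ConicVec) :
    (veroneseMatrix B).transpose.mulVec (chowForm h α) =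
      (veroneseMatrix (planeMatrix h * B)).transpose.mulVec α := by
  rw [chowForm, Matrix.mulVec_mulVec, veroneseMatrix_mul, Matrix.transpose_mul]

theorem veroneseMatrix_transpose_mulVec_mon (A : Matrix (Fin 3) (Fin 3) ℂ) (α : ConicVec)
    (k : Fin 6) : (veroneseMatrix A).transpose.mulVec α (mon k) =
      ∑ j, veroneseMatrix A (mon j) (mon k) * α (mon j) := by
  rw [Matrix.mulVec, dotProduct]
  exact (Equiv.sum_comp monEquiv _).symm

/-- The center is a multiple of (1, 0, 0, 0), so `joinMatrix c` kills the one row of `D` that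
`camera₁` leaves free, and the 3 × 3 matrix is scalar: the coordinates on the plane are those of the
first image. -/
theorem IsBackProjection.exists_view_camera₁ {B : Matrix (Fin 6) (Fin 3) ℂ}
    (hB : IsBackProjection camera₁ B) : ∃ c : ℂ, c ≠ 0 ∧ ∀ (h : Fin 4 → ℂ) (α : ConicVec),
      (veroneseMatrix B).transpose.mulVec (chowForm h α) = (c * h 0) ^ 2 • α := by
  obtain ⟨c, D, hc0, hc, hD, rfl⟩ := hB
  have hcam : ∀ i : Fin 3, c i.succ = 0 := fun i => by
    have := congrFun hc i
    fin_cases i <;> simpa [camera₁, Matrix.mulVec, dotProduct, Fin.sum_univ_four] using this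
  have h1 : c 1 = 0 := hcam 0
  have h2 : c 2 = 0 := hcam 1
  have h3 : c 3 = 0 := hcam 2
  have hinv : ∀ (i j : Fin 3), D i.succ j = (1 : Matrix (Fin 3) (Fin 3) ℂ) i j := fun i j => by
    rw [← hD]
    fin_cases i <;> simp [camera₁, Matrix.mul_apply, Fin.sum_univ_four]
  have hD1 : ∀ j, D 1 j = (1 : Matrix (Fin 3) (Fin 3) ℂ) 0 j := hinv 0
  have hD2 : ∀ j, D 2 j = (1 : Matrix (Fin 3) (Fin 3) ℂ) 1 j := hinv 1
  have hD3 : ∀ j, D 3 j = (1 : Matrix (Fin 3) (Fin 3) ℂ) 2 j := hinv 2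
  refine ⟨c 0, fun h0 => hc0 ?_, fun h α => ?_⟩
  · funext i
    fin_cases i <;> simp [h0, h1, h2, h3]
  have hmul : planeMatrix h * (joinMatrix c * D) =
      !![-(c 0 * h 0), 0, 0; 0, -(c 0 * h 0), 0; 0, 0, -(c 0 * h 0)] := by
    rw [← Matrix.mul_assoc]
    ext i j
    fin_cases i <;> fin_cases j <;> simp [planeMatrix, joinMatrix, Matrix.mul_apply,
      Fin.sum_univ_succ, h1, h2, h3, hD1, hD2, hD3] <;> ring
  rw [view_eq, hmul]
  funext s
  rw [← mon_monIdx s, veroneseMatrix_transpose_mulVec_mon, Fin.sum_univ_six]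
  generalize monIdx s = k
  fin_cases k <;>
    simp [mon, veroneseMatrix, Fintype.sum_prod_type, Fin.sum_univ_three] <;> left <;> ring

/-- Now the last row of `D` is free and killed; the 3 × 3 matrix is the substitution that defines
`secondView`, up to the factor `c 3`. -/
theorem IsBackProjection.exists_view_camera₂ {B : Matrix (Fin 6) (Fin 3) ℂ}
    (hB : IsBackProjection camera₂ B) : ∃ c : ℂ, c ≠ 0 ∧ ∀ (h : Fin 4 → ℂ) (α : ConicVec) k,
      (veroneseMatrix B).transpose.mulVec (chowForm h α) (mon k) =
        c ^ 2 * secondView (fun k => α (mon k)) h k := by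
  obtain ⟨c, D, hc0, hc, hD, rfl⟩ := hB
  have hcam : ∀ i : Fin 3, c i.castSucc = 0 := fun i => by
    have := congrFun hc i
    fin_cases i <;> simpa [camera₂, Matrix.mulVec, dotProduct, Fin.sum_univ_four] using this
  have h0 : c 0 = 0 := hcam 0
  have h1 : c 1 = 0 := hcam 1
  have h2 : c 2 = 0 := hcam 2
  have hinv : ∀ (i j : Fin 3), D i.castSucc j = (1 : Matrix (Fin 3) (Fin 3) ℂ) i j :=
    fun i j => by
      rw [← hD]
      fin_cases i <;> simp [camera₂, Matrix.mul_apply, Fin.sum_univ_four]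
  have hD0 : ∀ j, D 0 j = (1 : Matrix (Fin 3) (Fin 3) ℂ) 0 j := hinv 0
  have hD1 : ∀ j, D 1 j = (1 : Matrix (Fin 3) (Fin 3) ℂ) 1 j := hinv 1
  have hD2 : ∀ j, D 2 j = (1 : Matrix (Fin 3) (Fin 3) ℂ) 2 j := hinv 2
  refine ⟨c 3, fun h3 => hc0 ?_, fun h α k => ?_⟩
  · funext i
    fin_cases i <;> simp [h0, h1, h2, h3]
  have hmul : planeMatrix h * (joinMatrix c * D) =
      !![0, -(c 3 * h 3), 0; 0, 0, -(c 3 * h 3); c 3 * h 0, c 3 * h 1, c 3 * h 2] := by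
    rw [← Matrix.mul_assoc]
    ext i j
    fin_cases i <;> fin_cases j <;> simp [planeMatrix, joinMatrix, Matrix.mul_apply,
      Fin.sum_univ_succ, h0, h1, h2, hD0, hD1, hD2] <;> ring
  rw [view_eq, hmul, veroneseMatrix_transpose_mulVec_mon, Fin.sum_univ_six]
  fin_cases k <;>
    simp [mon, veroneseMatrix, Fintype.sum_prod_type, Fin.sum_univ_three, secondView] <;> ring

theorem exists_isBackProjection_camera₁ : ∃ B, IsBackProjection camera₁ B := by
  refine ⟨_, ![1, 0, 0, 0], !![0, 0, 0; 1, 0, 0; 0, 1, 0; 0, 0, 1], ?_, ?_, ?_, rfl⟩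
  · exact fun h => one_ne_zero (congrFun h 0)
  · funext i
    fin_cases i <;> simp [camera₁]
  · ext i j
    fin_cases i <;> fin_cases j <;> simp [camera₁, Matrix.mul_apply, Fin.sum_univ_four]

theorem exists_isBackProjection_camera₂ : ∃ B, IsBackProjection camera₂ B := by
  refine ⟨_, ![0, 0, 0, 1], !![1, 0, 0; 0, 1, 0; 0, 0, 1; 0, 0, 0], ?_, ?_, ?_, rfl⟩
  · exact fun h => one_ne_zero (congrFun h 3)
  · funext i
    fin_cases i <;> simp [camera₂]
  · ext i j
    fin_cases i <;> fin_cases j <;> simp [camera₂, Matrix.mul_apply, Fin.sum_univ_four]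

/-! ### The defining ideal of the conic multiview variety -/

theorem exists_smul_of_mk_eq {v w : ConicVec} {hv : v ≠ 0} {hw : w ≠ 0}
    (h : Projectivization.mk ℂ v hv = Projectivization.mk ℂ w hw) : ∃ a : ℂ, v = a • w := by
  obtain ⟨a, ha⟩ := (Projectivization.mk_eq_mk_iff' ℂ v w hv hw).1 h
  exact ⟨a, ha.symm⟩

theorem eval_coords_eq_pairPoint (v : Fin 2 → ConicVec) (f : CoordRing 2) :
    eval (fun x => v x.1 x.2) f =
      eval (pairPoint (fun k => v 0 (mon k)) fun k => v 1 (mon k)) f := by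
  rw [← pairPoint_coords fun x : Fin 2 × Sym2 (Fin 3) => v x.1 x.2]

theorem eval_mem_rowMinors {f : CoordRing 2} (hf : f ∈ discIdeal) (γ δ : Fin 6 → ℂ) :
    eval (pairPoint γ δ) f ∈ rowMinors (gDisc γ) (dDisc δ) :=
  map_mem_rowMinors (eval (pairPoint γ δ)) (by intro i; fin_cases i <;> simp [gDisc])
    (by intro i; fin_cases i <;> simp [dDisc]) hf

theorem gDisc_smul {R : Type*} [CommRing R] (γ : Fin 6 → R) (c : R) (i : Fin 3) :
    gDisc (c • γ) i = c ^ 2 * gDisc γ i := by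
  fin_cases i <;> simp [gDisc] <;> ring

theorem dDisc_smul {R : Type*} [CommRing R] (δ : Fin 6 → R) (c : R) (i : Fin 3) :
    dDisc (c • δ) i = c ^ 2 * dDisc δ i := by
  fin_cases i <;> simp [dDisc] <;> ring

theorem rowMinors_le_of_eq_mul {R : Type*} [CommRing R] {r r' q q' : Fin 3 → R} {c c' : R}
    (h : ∀ i, r i = c * q i) (h' : ∀ i, r' i = c' * q' i) : rowMinors r r' ≤ rowMinors q q' := by
  intro f hf
  obtain ⟨u, v, w, rfl⟩ := mem_rowMinors.1 hf
  refine mem_rowMinors.2 ⟨c * c' * u, c * c' * v, c * c' * w, ?_⟩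
  simp only [h, h']
  ring

/-- Rescaling either conic rescales its discriminant, so any representatives may be tested. -/
theorem vanishesAt_of_mem_discIdeal {f : CoordRing 2} (hf : f ∈ discIdeal)
    {p : Fin 2 → ConicSpace} {γ δ : ConicVec} {hγ : γ ≠ 0} {hδ : δ ≠ 0}
    (hp₁ : p 0 = Projectivization.mk ℂ γ hγ) (hp₂ : p 1 = Projectivization.mk ℂ δ hδ)
    (h : rowMinors (gDisc fun k => γ (mon k)) (dDisc fun k => δ (mon k)) = ⊥) :
    VanishesAt f p := by
  intro v hv
  obtain ⟨hv₁, hvp₁⟩ := hv 0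
  obtain ⟨hv₂, hvp₂⟩ := hv 1
  obtain ⟨a, ha⟩ := exists_smul_of_mk_eq (hvp₁.trans hp₁)
  obtain ⟨b, hb⟩ := exists_smul_of_mk_eq (hvp₂.trans hp₂)
  have hm := rowMinors_le_of_eq_mul (gDisc_smul _ a) (dDisc_smul _ b)
    (eval_mem_rowMinors hf (a • fun k => γ (mon k)) (b • fun k => δ (mon k)))
  rw [h, Ideal.mem_bot] at hm
  rw [eval_coords_eq_pairPoint, ha, hb]
  exact hm

theorem vanishesAt_of_mem_jointImage {f : CoordRing 2} (hf : f ∈ discIdeal)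
    {p : Fin 2 → ConicSpace} (hp : p ∈ jointImage ![camera₁, camera₂]) : VanishesAt f p := by
  obtain ⟨h, α, -, -, hp⟩ := hp
  obtain ⟨B₁, hB₁, hne₁, hp₁⟩ := hp 0
  obtain ⟨B₂, hB₂, hne₂, hp₂⟩ := hp 1
  refine vanishesAt_of_mem_discIdeal hf hp₁ hp₂ ?_
  obtain ⟨c, -, hc⟩ := IsBackProjection.exists_view_camera₁ hB₁
  obtain ⟨d, -, hd⟩ := IsBackProjection.exists_view_camera₂ hB₂
  simp only [hc, hd]
  exact rowMinors_eq_bot (gDisc_smul (fun k => α (mon k)) _) (dDisc_smul_secondView _ _ _)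

theorem mem_discIdeal_of_vanishesAt {f : CoordRing 2}
    (hf : ∀ p ∈ jointImage ![camera₁, camera₂], VanishesAt f p) : f ∈ discIdeal := by
  refine mem_discIdeal_of_eval_eq_zero fun γ x c h5 hx hc => ?_
  obtain ⟨B₁, hB₁⟩ := exists_isBackProjection_camera₁
  obtain ⟨B₂, hB₂⟩ := exists_isBackProjection_camera₂
  obtain ⟨a, ha, hview₁⟩ := hB₁.exists_view_camera₁
  obtain ⟨b, hb, hview₂⟩ := hB₂.exists_view_camera₂
  set α : ConicVec := fun s => γ (monIdx s) with hα
  set β : ConicVec := fun s => c * secondView γ x (monIdx s) with hβ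
  have hα0 : α ≠ 0 := fun h => h5 (by simpa [hα] using congrFun h (mon 5))
  -- The coefficient of x₀² is c γ₅ h₀².
  have hβ0 : β ≠ 0 := fun h => by
    simpa [hβ, secondView, h5, hx, hc] using congrFun h (mon 0)
  have hβ' : (veroneseMatrix B₂).transpose.mulVec (chowForm x α) = (b ^ 2 / c) • β := by
    funext s
    rw [← mon_monIdx s, hview₂]
    simp [hα, hβ]
    field_simp
  have hne₁ : (veroneseMatrix B₁).transpose.mulVec (chowForm x α) ≠ 0 := by
    rw [hview₁]
    exact smul_ne_zero (by simp [ha, hx]) hα0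
  have hne₂ : (veroneseMatrix B₂).transpose.mulVec (chowForm x α) ≠ 0 := by
    rw [hβ']
    exact smul_ne_zero (by simp [hb, hc]) hβ0
  have h := hf ![Projectivization.mk ℂ _ hne₁, Projectivization.mk ℂ _ hne₂]
    ⟨x, α, fun h => hx (congrFun h 0), hα0, by
      intro i
      fin_cases i
      · exact ⟨B₁, hB₁, hne₁, rfl⟩
      · exact ⟨B₂, hB₂, hne₂, rfl⟩⟩ ![α, β] (by
      intro i
      fin_cases i
      · exact ⟨hα0, (Projectivization.mk_eq_mk_iff' ℂ _ _ _ _).2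
          ⟨((a * x 0) ^ 2)⁻¹, by rw [hview₁]; exact inv_smul_smul₀ (by simp [ha, hx]) _⟩⟩
      · exact ⟨hβ0, (Projectivization.mk_eq_mk_iff' ℂ _ _ _ _).2
          ⟨(b ^ 2 / c)⁻¹, by rw [hβ']; exact inv_smul_smul₀ (by simp [hb, hc]) _⟩⟩)
  rw [eval_coords_eq_pairPoint] at h
  convert h using 4
  · funext k
    simp [hα]
  · funext k
    simp [hβ]

/-- The weights of the multigrading on the coordinate ring. -/
def blockWeight (x : Fin 2 × Sym2 (Fin 3)) : Fin 2 → ℕ := Pi.single x.1 1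

theorem isWeightedHomogeneous_ofNat_mul {w : Fin 2 → ℕ} {f : CoordRing 2} (n : ℕ)
    [n.AtLeastTwo] (hf : f.IsWeightedHomogeneous blockWeight w) :
    (ofNat(n) * f).IsWeightedHomogeneous blockWeight w := by
  have := (isWeightedHomogeneous_C blockWeight (ofNat(n) : ℂ)).mul hf
  rwa [map_ofNat, zero_add] at this

theorem isWeightedHomogeneous_gDisc (i : Fin 3) :
    (gDisc gVar i).IsWeightedHomogeneous blockWeight (Pi.single 0 2) := by
  have hX : ∀ k, (gVar k).IsWeightedHomogeneous blockWeight (Pi.single 0 1) := fun k =>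
    isWeightedHomogeneous_X ℂ blockWeight (0, mon k)
  have hXX : ∀ j k, (gVar j * gVar k).IsWeightedHomogeneous blockWeight (Pi.single 0 2) :=
    fun j k => by simpa [← Pi.single_add] using (hX j).mul (hX k)
  fin_cases i <;> simp only [gDisc, sq, mul_assoc] <;>
    exact (hXX _ _).sub (isWeightedHomogeneous_ofNat_mul _ (hXX _ _))

theorem isWeightedHomogeneous_dDisc (i : Fin 3) :
    (dDisc dVar i).IsWeightedHomogeneous blockWeight (Pi.single 1 2) := by
  have hX : ∀ k, (dVar k).IsWeightedHomogeneous blockWeight (Pi.single 1 1) := fun k =>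
    isWeightedHomogeneous_X ℂ blockWeight (1, mon k)
  have hXX : ∀ j k, (dVar j * dVar k).IsWeightedHomogeneous blockWeight (Pi.single 1 2) :=
    fun j k => by simpa [← Pi.single_add] using (hX j).mul (hX k)
  fin_cases i <;> simp only [dDisc, sq, mul_assoc] <;>
    exact (hXX _ _).sub (isWeightedHomogeneous_ofNat_mul _ (hXX _ _))

/-- Needed because the closure is cut out by multihomogeneous polynomials only. -/
theorem isMultihomogeneous_minor (i j : Fin 3) :
    IsMultihomogeneous (gDisc gVar i * dDisc dVar j - gDisc gVar j * dDisc dVar i) :=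
  ⟨_, ((isWeightedHomogeneous_gDisc i).mul (isWeightedHomogeneous_dDisc j)).sub
    ((isWeightedHomogeneous_gDisc j).mul (isWeightedHomogeneous_dDisc i))⟩

theorem subset_zariskiClosure {n : ℕ} (S : Set (Fin n → ConicSpace)) : S ⊆ zariskiClosure S :=
  fun p hp _ _ hf => hf p hp

theorem discIdeal_eq_definingIdeal :
    discIdeal = definingIdeal (conicMultiviewVariety ![camera₁, camera₂]) := by
  apply le_antisymm
  · have hminor : ∀ i j : Fin 3, gDisc gVar i * dDisc dVar j - gDisc gVar j * dDisc dVar i ∈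
        discIdeal → gDisc gVar i * dDisc dVar j - gDisc gVar j * dDisc dVar i ∈
        definingIdeal (conicMultiviewVariety ![camera₁, camera₂]) := fun i j h p hp =>
      hp _ (isMultihomogeneous_minor i j) fun q hq => vanishesAt_of_mem_jointImage h hq
    rw [discIdeal, rowMinors, Ideal.span_le]
    rintro f (rfl | rfl | rfl)
    · exact hminor 0 1 (Ideal.subset_span (by simp))
    · exact hminor 0 2 (Ideal.subset_span (by simp))
    · exact hminor 1 2 (Ideal.subset_span (by simp))
  · exact fun f hf => mem_discIdeal_of_vanishesAt fun p hp => hf p (subset_zariskiClosure _ hp)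

/-! ### Membership in the conic multiview variety -/

theorem rowMinors_eq_bot_iff {R : Type*} [CommRing R] {r r' : Fin 3 → R} :
    rowMinors r r' = ⊥ ↔ r 0 * r' 1 - r 1 * r' 0 = 0 ∧ r 0 * r' 2 - r 2 * r' 0 = 0 ∧
      r 1 * r' 2 - r 2 * r' 1 = 0 := by
  simp [rowMinors]

theorem rank_le_one_iff_rowMinors_eq_bot {K : Type*} [Field K] (M : Matrix (Fin 2) (Fin 3) K) :
    M.rank ≤ 1 ↔ rowMinors (M 0) (M 1) = ⊥ := by
  constructor
  · intro h
    have hdep : ¬ LinearIndependent K ![M 0, M 1] := fun hli => by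
      have hrow : M.row = ![M 0, M 1] := by
        funext i
        fin_cases i <;> rfl
      have := LinearIndependent.rank_matrix (hrow ▸ hli)
      rw [Fintype.card_fin] at this
      omega
    have hminor : ∀ i j, M 0 i * M 1 j - M 0 j * M 1 i = 0 := by
      intro i j
      by_contra hne
      refine hdep (LinearIndependent.pair_iff.2 fun s t hst => ?_)
      have hi : s * M 0 i + t * M 1 i = 0 := congrFun hst i
      have hj : s * M 0 j + t * M 1 j = 0 := congrFun hst j
      constructor <;> refine (mul_eq_zero.1 ?_).resolve_right hne
      · linear_combination M 1 j * hi - M 1 i * hj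
      · linear_combination M 0 i * hj - M 0 j * hi
    exact rowMinors_eq_bot_iff.2 ⟨hminor 0 1, hminor 0 2, hminor 1 2⟩
  · intro h
    obtain ⟨h01, h02, h12⟩ := rowMinors_eq_bot_iff.1 h
    have hz : ∀ i j, M 0 i * M 1 j = M 0 j * M 1 i := by
      intro i j
      fin_cases i <;> fin_cases j <;> simp <;> grind
    by_cases h0 : M 0 = 0
    · have : M = Matrix.vecMulVec ![0, 1] (M 1) := by
        ext i j
        fin_cases i <;> simp [Matrix.vecMulVec_apply, h0]
      rw [this]
      exact Matrix.rank_vecMulVec_le _ _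
    · obtain ⟨j, hj⟩ := Function.ne_iff.1 h0
      replace hj : M 0 j ≠ 0 := hj
      have : M = Matrix.vecMulVec ![1, M 1 j / M 0 j] (M 0) := by
        ext i k
        fin_cases i
        · simp [Matrix.vecMulVec_apply]
        · simp only [Matrix.vecMulVec_apply]
          change M 1 k = M 1 j / M 0 j * M 0 k
          field_simp
          linear_combination hz j k
      rw [this]
      exact Matrix.rank_vecMulVec_le _ _

theorem mem_conicMultiviewVariety_iff (γ δ : ConicVec) (hγ : γ ≠ 0) (hδ : δ ≠ 0) :
    ![Projectivization.mk ℂ γ hγ, Projectivization.mk ℂ δ hδ] ∈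
        conicMultiviewVariety ![camera₁, camera₂] ↔
      rowMinors (gDisc fun k => γ (mon k)) (dDisc fun k => δ (mon k)) = ⊥ := by
  constructor
  · intro hp
    have hmem : ∀ f ∈ discIdeal,
        eval (pairPoint (fun k => γ (mon k)) fun k => δ (mon k)) f = 0 := by
      intro f hf
      rw [discIdeal_eq_definingIdeal] at hf
      have := hf _ hp ![γ, δ] (by
        intro i
        fin_cases i
        · exact ⟨hγ, rfl⟩
        · exact ⟨hδ, rfl⟩)
      rwa [eval_coords_eq_pairPoint] at this
    rw [rowMinors_eq_bot_iff]
    refine ⟨?_, ?_, ?_⟩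
    · simpa [gDisc, dDisc] using hmem (gDisc gVar 0 * dDisc dVar 1 - gDisc gVar 1 * dDisc dVar 0)
        (Ideal.subset_span (by simp))
    · simpa [gDisc, dDisc] using hmem (gDisc gVar 0 * dDisc dVar 2 - gDisc gVar 2 * dDisc dVar 0)
        (Ideal.subset_span (by simp))
    · simpa [gDisc, dDisc] using hmem (gDisc gVar 1 * dDisc dVar 2 - gDisc gVar 2 * dDisc dVar 1)
        (Ideal.subset_span (by simp))
  · exact fun h f _ hf =>
      vanishesAt_of_mem_discIdeal (mem_discIdeal_of_vanishesAt hf) rfl rfl h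

end ConicMultiview

theorem theorem4p1 :
    (∀ (γ δ : ConicMultiview.ConicVec) (hγ : γ ≠ 0) (hδ : δ ≠ 0),
      (![Projectivization.mk ℂ γ hγ, Projectivization.mk ℂ δ hδ] ∈
          ConicMultiview.conicMultiviewVariety
            ![ConicMultiview.camera₁, ConicMultiview.camera₂] ↔
        (ConicMultiview.twoViewMatrix (fun k => γ (ConicMultiview.mon k))
          (fun k => δ (ConicMultiview.mon k))).rank ≤ 1)) ∧
    ConicMultiview.minorsIdeal
        (ConicMultiview.twoViewMatrix
          (fun k => (MvPolynomial.X (0, ConicMultiview.mon k) : ConicMultiview.CoordRing 2))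
          (fun k => MvPolynomial.X (1, ConicMultiview.mon k))) =
      ConicMultiview.definingIdeal
        (ConicMultiview.conicMultiviewVariety
          ![ConicMultiview.camera₁, ConicMultiview.camera₂]) ∧
    (ConicMultiview.definingIdeal
        (ConicMultiview.conicMultiviewVariety
          ![ConicMultiview.camera₁, ConicMultiview.camera₂])).IsPrime := by
  have hideal : ConicMultiview.minorsIdeal
      (ConicMultiview.twoViewMatrix
        (fun k => (MvPolynomial.X (0, ConicMultiview.mon k) : ConicMultiview.CoordRing 2))
        (fun k => MvPolynomial.X (1, ConicMultiview.mon k))) = ConicMultiview.discIdeal :=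
    ConicMultiview.minorsIdeal_twoViewMatrix _ _
  refine ⟨fun γ δ hγ hδ => ?_, ?_, ?_⟩
  · rw [ConicMultiview.mem_conicMultiviewVariety_iff,
      ConicMultiview.rank_le_one_iff_rowMinors_eq_bot]
    rfl
  · rw [hideal, ConicMultiview.discIdeal_eq_definingIdeal]
  · rw [← ConicMultiview.discIdeal_eq_definingIdeal]
    exact ConicMultiview.isPrime_discIdeal
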